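/- Let $(\Omega,\mathcal A,\mathbb P)$ be a probability space and let $X_1,X_2,\dots$ be i.i.d. random variables on it with values in a measurable space $Y$ and with image measure $P$. Let $\mathcal F$ be a countable set of measurable functions $f\colon Y\to[0,1]$. For each $q\in\{0,1,2,\dots\}$ let $N_{[]}(q,\mathcal F,P)\in\mathbb N$, and let $l_{q,i},u_{q,i}\in L^2(P)$, $1\le i\le N_{[]}(q,\mathcal F,P)$, be real functions on $Y$ that form a *nested monotone bracketing cover* of $\mathcal F$, that is, for all $q$ and all $1\le i\le N_{[]}(q,\mathcal F,P)$: 1. $l_{q,i}(y)\le u_{q,i}(y)$ for all $y\in Y$, and $u_{q,i}(y)\le l_{q,i+1}(y)$ for all $y\in Y$ if $i+1\le N_{[]}(q,\mathcal F,P)$; 2. every $f\in\mathcal F$ satisfies $l_{q,j}\le f\le u_{q,j}$ pointwise on $Y$ for some $1\le j\le N_{[]}(q,\mathcal F,P)$; 3. $\|u_{q,i}-l_{q,i}\|_{L^2(P)}<2^{-q}$; 4. for every $t\in\{0,1,2,\dots\}$, $l_{q,i}$ is one of the functions $l_{q+t,j}$ and $u_{q,i}$ is one of the functions $u_{q+t,j}$,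 $1\le j\le N_{[]}(q+t,\mathcal F,P)$. For a real random variable $Z$ and $M\ge 2$ let $\psi_{1,M}(x)=\frac1M e^{x}$ and $$\|Z\|_{\psi_{1,M}}=\inf\Big\{C>0:\ \mathbb E\,\psi_{1,M}\Big(\frac{|Z|}{C}\Big)\le 1\Big\}\in[0,\infty],\qquad \inf\emptyset=\infty .$$ Then for every integer $s\ge 1$ and every real $M\ge 2$, $$\Big\|\sup_{f\in\mathcal F}\Big|\frac1{\sqrt s}\sum_{i=1}^s\big(f(X_i)-\mathbb E f(X_i)\big)\Big|\,\Big\|_{\psi_{1,M}}\ \le\ K''_{\psi,M}\sum_{q=0}^\infty 2^{-q}\sqrt{2+\log N_{[]}(q,\mathcal F,P)},$$ where $$K'_{\psi,M}=\frac{4(M+1)}{\log(3/2)\,(M-1)},\qquad K''_{\psi,M}=10\,K'_{\psi,M}+\frac{4}{\log M},$$ and the right-hand side may be $+\infty$. (In the degenerate case $\mathcal F=\emptyset$, the supremum is read as $0$ and $\log 0$ as $0$.) -/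

import Mathlib

open MeasureTheory ProbabilityTheory
open scoped ENNReal

namespace BracketingChaining

noncomputable section

/-- The Orlicz norm `inf {C > 0 : E Φ(|X| / C) ≤ 1}` of a real random variable `X`, with values in
`[0, ∞]` and `inf ∅ = ∞`. It is used for monotone `Φ` with `0 ≤ Φ 0`, so that `Φ (|X| / C) ≥ 0`
and its expectation is a Lebesgue integral with values in `[0, ∞]`. -/
def orliczNorm {Ω : Type*} [MeasurableSpace Ω] (Φ : ℝ → ℝ) (X : Ω → ℝ) (μ : Measure Ω) : ℝ≥0∞ :=
  ⨅ (C : ℝ) (_ : 0 < C ∧ ∫⁻ ω, ENNReal.ofReal (Φ (|X ω| / C)) ∂μ ≤ 1), ENNReal.ofReal C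

/-- The function `ψ_{1,M}(x) = e^x / M`. -/
def psiOne (M : ℝ) (x : ℝ) : ℝ := 1 / M * Real.exp x

/-- The empirical process `G_s(f) = s^{-1/2} ∑_{i < s} (f(X_i) - E f(X_i))`
(the random variables are numbered from `0`). -/
def empiricalMap {Ω Y : Type*} [MeasurableSpace Ω] (μ : Measure Ω) (X : ℕ → Ω → Y) (s : ℕ)
    (f : Y → ℝ) (ω : Ω) : ℝ :=
  1 / √(s : ℝ) * ∑ i ∈ Finset.range s, (f (X i ω) - ∫ ω', f (X i ω') ∂μ)

/-- The bracket `[l, u]`. -/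
def bracket {Y : Type*} (l u : Y → ℝ) : Set (Y → ℝ) := {f | ∀ y, l y ≤ f y ∧ f y ≤ u y}

/-- The brackets `[l i, u i]`, for `i` in `Fin N`, form a monotone bracketing cover of `F`. -/
structure IsMonotoneBracketingCover {Y : Type*} (F : Set (Y → ℝ)) (N : ℕ)
    (l u : Fin N → Y → ℝ) : Prop where
  lower_le_upper : ∀ i y, l i y ≤ u i y
  upper_le_next_lower : ∀ i j : Fin N, (j : ℕ) = i + 1 → ∀ y, u i y ≤ l j y
  cover : F ⊆ ⋃ i, bracket (l i) (u i)

/-- The families `[l q i, u q i]`, for `i` in `Fin (N q)` and `q = 0, 1, 2, …`, form a nested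
monotone bracketing cover of `F` with regard to `P`; its monotone bracketing function is `N`. -/
structure IsNestedMonotoneBracketingCover {Y : Type*} [MeasurableSpace Y] (P : Measure Y)
    (F : Set (Y → ℝ)) (N : ℕ → ℕ) (l u : (q : ℕ) → Fin (N q) → Y → ℝ) : Prop where
  isCover : ∀ q, IsMonotoneBracketingCover F (N q) (l q) (u q)
  memLp_lower : ∀ q i, MemLp (l q i) 2 P
  memLp_upper : ∀ q i, MemLp (u q i) 2 P
  size_lt : ∀ q i, eLpNorm (u q i - l q i) 2 P < ENNReal.ofReal ((1 / 2 : ℝ) ^ q)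
  nested_lower : ∀ q t i, l q i ∈ Set.range (l (q + t))
  nested_upper : ∀ q t i, u q i ∈ Set.range (u (q + t))

/-- The constant `K'_{ψ,M} = 4 (M + 1) / (log (3/2) (M - 1))`. -/
def constK' (M : ℝ) : ℝ := 4 * (M + 1) / (Real.log (3 / 2) * (M - 1))

/-- The constant `K''_{ψ,M} = 10 K'_{ψ,M} + 4 / log M`. -/
def constK'' (M : ℝ) : ℝ := 10 * constK' M + 4 / Real.log M

end

end BracketingChaining

namespace BracketingChaining

noncomputable section

/-! The proof is bracketing chaining with truncation along the chain. Fix for each `f` one bracket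
per level. The intersection of its brackets of levels `≤ q` with `[0, 1]` has a lower end that
increases with `q` and a width that decreases. At a point `y` the chain of lower ends is followed
until the width first exceeds a threshold `t q`. This writes `f` as a sum of increments of the lower
ends, remainders at the stopping level and a remainder that never stopped (`chain_decomposition`).
Remainders still depend on `f`, but by positivity they are dominated by widths, at the price of a
bias `√s * ∫ stoppedGap`.

Write `H q = entropySum N q`. The links of level `q` depend only on the brackets of levels `≤ q`, so
there are at most `∏_{r ≤ q} N r` of them, and twice this number is at most `exp (H q ^ 2)`. For `q
≥ 1` they are bounded by `t (q - 1)` and have second moment at most `4 ^ (-(q - 1))`. The threshold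
`t q = √s * 2 ^ (-q) / H (q + 1)` balances two demands: the Bernstein bound just applies at the
exponent `H q / linkScale q` (`integral_exp_link_le`), and Markov's inequality bounds the bias by `2
^ (-q) * H (q + 1)`. After level `s` the surviving remainder contributes at most `1`.

A weighted Jensen inequality combines the exponential moments of all levels into one for the
supremum (`lintegral_exp_iSup_le`). Since `∑ 2 ^ (-q) * H q` is at most twice the entropy series,
all costs are multiples of that series. The resulting constant `50` lies below `constK'' M`. -/

/-- Almost everywhere measurable functions with values in the unit interval. -/
structure IsUnitFun {Y : Type*} [MeasurableSpace Y] (P : Measure Y) (g : Y → ℝ) : Prop where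
  aemeasurable : AEMeasurable g P
  nonneg : ∀ y, 0 ≤ g y
  le_one : ∀ y, g y ≤ 1

/-! ### Moment generating functions of one centred summand -/

section Mgf

variable {Ω : Type*} [MeasurableSpace Ω] {μ : Measure Ω} [IsProbabilityMeasure μ]

lemma IsUnitFun.integrable {g : Ω → ℝ} (hg : IsUnitFun μ g) : Integrable g μ :=
  Integrable.of_mem_Icc 0 1 hg.aemeasurable (.of_forall fun y => ⟨hg.nonneg y, hg.le_one y⟩)

lemma IsUnitFun.integrable_sq {g : Ω → ℝ} (hg : IsUnitFun μ g) :
    Integrable (fun y => g y ^ 2) μ :=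
  Integrable.of_mem_Icc 0 1 (hg.aemeasurable.pow_const 2)
    (.of_forall fun y => ⟨sq_nonneg _, pow_le_one₀ (hg.nonneg y) (hg.le_one y)⟩)

lemma IsUnitFun.integrable_exp_mul {g : Ω → ℝ} (hg : IsUnitFun μ g) (c t : ℝ) :
    Integrable (fun ω => Real.exp (t * (g ω - c))) μ :=
  integrable_exp_mul_of_mem_Icc (a := 0 - c) (b := 1 - c) (hg.aemeasurable.sub_const c)
    (.of_forall fun y => ⟨sub_le_sub_right (hg.nonneg y) c, sub_le_sub_right (hg.le_one y) c⟩)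

/-- A Bernstein type bound for the moment generating function of a small random variable. -/
lemma mgf_centered_le_of_mul_le_one {g : Ω → ℝ} (hg : IsUnitFun μ g) {b v t : ℝ}
    (hb : ∀ ω, g ω ≤ b) (hv : ∫ ω, g ω ^ 2 ∂μ ≤ v) (ht : |t| * b ≤ 1) :
    mgf (fun ω => g ω - ∫ ω', g ω' ∂μ) μ t ≤ Real.exp (t ^ 2 * v) := by
  set m := ∫ ω', g ω' ∂μ with hm
  have hm0 : 0 ≤ m := integral_nonneg hg.nonneg
  have hmb : m ≤ b := by
    have := integral_mono hg.integrable (integrable_const b) hb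
    simpa using this
  have hpt : ∀ ω, Real.exp (t * (g ω - m)) ≤ 1 + t * (g ω - m) + t ^ 2 * (g ω - m) ^ 2 := by
    intro ω
    have hd : |g ω - m| ≤ b :=
      abs_le.2 ⟨by linarith [hg.nonneg ω], by linarith [hb ω]⟩
    -- Both `g ω` and its mean lie in `[0, b]`, so centring does not enlarge the range; `exp x ≤ 1 +
    -- x + x ^ 2` holds for `|x| ≤ 1`.
    have hx : |t * (g ω - m)| ≤ 1 := by
      rw [abs_mul]
      exact (mul_le_mul_of_nonneg_left hd (abs_nonneg t)).trans ht
    have := (abs_le.1 (Real.abs_exp_sub_one_sub_id_le hx)).2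
    rw [mul_pow] at this
    linarith
  have hi1 : Integrable (fun ω => g ω - m) μ := hg.integrable.sub (integrable_const m)
  have hi2 : Integrable (fun ω => (g ω - m) ^ 2) μ := by
    have : (fun ω => (g ω - m) ^ 2) = fun ω => g ω ^ 2 - 2 * m * g ω + m ^ 2 := by
      ext ω; ring
    rw [this]
    exact (hg.integrable_sq.sub (hg.integrable.const_mul _)).add (integrable_const _)
  have hvar : ∫ ω, (g ω - m) ^ 2 ∂μ ≤ v := by
    have h : ∫ ω, (g ω - m) ^ 2 ∂μ = ∫ ω, g ω ^ 2 ∂μ - m ^ 2 := by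
      have : (fun ω => (g ω - m) ^ 2) = fun ω => g ω ^ 2 - 2 * m * g ω + m ^ 2 := by
        ext ω; ring
      have hi3 : Integrable (fun ω => g ω ^ 2 - 2 * m * g ω) μ :=
        hg.integrable_sq.sub (hg.integrable.const_mul _)
      rw [this, integral_add hi3 (integrable_const _), integral_sub hg.integrable_sq (hg.integrable.const_mul _),
        integral_const_mul, ← hm]
      simp
      ring
    rw [h]
    linarith [sq_nonneg m]
  have hz : ∫ ω, (g ω - m) ∂μ = 0 := by
    rw [integral_sub hg.integrable (integrable_const m), ← hm]
    simp
  have hi4 : Integrable (fun ω => 1 + t * (g ω - m)) μ :=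
    (integrable_const 1).add (hi1.const_mul t)
  calc mgf (fun ω => g ω - m) μ t
      ≤ ∫ ω, (1 + t * (g ω - m) + t ^ 2 * (g ω - m) ^ 2) ∂μ :=
        integral_mono (hg.integrable_exp_mul m t)
          (hi4.add (hi2.const_mul (t ^ 2))) hpt
    _ = 1 + t ^ 2 * ∫ ω, (g ω - m) ^ 2 ∂μ := by
        rw [integral_add hi4 (hi2.const_mul (t ^ 2)),
          integral_add (integrable_const 1) (hi1.const_mul t), integral_const_mul,
          integral_const_mul, hz]
        simp
    _ ≤ 1 + t ^ 2 * v := by gcongr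
    _ ≤ Real.exp (t ^ 2 * v) := by linarith [Real.add_one_le_exp (t ^ 2 * v)]

/-- Hoeffding's lemma gives the exponent `t ^ 2 / 8`. The weaker form matches the Bernstein bound
with `v = 1` and serves level `0`, where no earlier bracket bounds the link. -/
lemma mgf_centered_le_of_unit {g : Ω → ℝ} (hg : IsUnitFun μ g) (t : ℝ) :
    mgf (fun ω => g ω - ∫ ω', g ω' ∂μ) μ t ≤ Real.exp (t ^ 2) := by
  refine ((hasSubgaussianMGF_of_mem_Icc (a := 0) (b := 1) hg.aemeasurable
    (.of_forall fun y => ⟨hg.nonneg y, hg.le_one y⟩)).mgf_le t).trans ?_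
  apply Real.exp_le_exp.2
  norm_num
  nlinarith [sq_nonneg t]

end Mgf

/-! ### The empirical process at a single function -/

section Empirical

variable {Ω Y : Type*} [MeasurableSpace Ω] [MeasurableSpace Y]
  {μ : Measure Ω} {P : Measure Y} {X : ℕ → Ω → Y}

lemma IsUnitFun.comp {g : Y → ℝ} (hg : IsUnitFun P g) (hX : ∀ i, Measurable (X i))
    (hlaw : ∀ i, μ.map (X i) = P) (i : ℕ) : IsUnitFun μ (fun ω => g (X i ω)) where
  aemeasurable := AEMeasurable.comp_measurable (by rw [hlaw i]; exact hg.aemeasurable) (hX i)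
  nonneg _ := hg.nonneg _
  le_one _ := hg.le_one _

lemma integral_comp_law {g : Y → ℝ} (hg : AEMeasurable g P) (hX : ∀ i, Measurable (X i))
    (hlaw : ∀ i, μ.map (X i) = P) (i : ℕ) : ∫ ω, g (X i ω) ∂μ = ∫ y, g y ∂P := by
  rw [← hlaw i] at hg ⊢
  exact (integral_map (hX i).aemeasurable hg.aestronglyMeasurable).symm

lemma aemeasurable_empiricalMap {g : Y → ℝ} (hg : IsUnitFun P g) (hX : ∀ i, Measurable (X i))
    (hlaw : ∀ i, μ.map (X i) = P) (s : ℕ) : AEMeasurable (empiricalMap μ X s g) μ := by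
  unfold empiricalMap
  exact (Finset.aemeasurable_fun_sum _ fun i _ =>
    (hg.comp hX hlaw i).aemeasurable.sub_const _).const_mul _

variable [IsProbabilityMeasure μ]

/-- The pointwise bound `√s * c` for the empirical process at functions with values in `[0, c]`. -/
lemma abs_empiricalMap_le {g : Y → ℝ} (hg : IsUnitFun P g) (hX : ∀ i, Measurable (X i))
    (hlaw : ∀ i, μ.map (X i) = P) (s : ℕ) {c : ℝ} (hc : ∀ y, g y ≤ c) (ω : Ω) :
    |empiricalMap μ X s g ω| ≤ √(s : ℝ) * c := by
  have hterm : ∀ i ∈ Finset.range s, |g (X i ω) - ∫ ω', g (X i ω') ∂μ| ≤ c := by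
    intro i _
    have h0 : 0 ≤ ∫ ω', g (X i ω') ∂μ := integral_nonneg (hg.comp hX hlaw i).nonneg
    have h1 : ∫ ω', g (X i ω') ∂μ ≤ c := by
      simpa using integral_mono (hg.comp hX hlaw i).integrable (integrable_const c)
        (fun ω' => hc (X i ω'))
    exact abs_le.2 ⟨by linarith [hg.nonneg (X i ω)], by linarith [hc (X i ω)]⟩
  have hs : 1 / √(s : ℝ) * s = √(s : ℝ) := by
    rw [one_div, inv_mul_eq_div, Real.div_sqrt]
  calc |empiricalMap μ X s g ω|
      = 1 / √(s : ℝ) * |∑ i ∈ Finset.range s, (g (X i ω) - ∫ ω', g (X i ω') ∂μ)| := by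
        rw [empiricalMap, abs_mul, abs_of_nonneg (by positivity)]
    _ ≤ 1 / √(s : ℝ) * (s * c) := by
        gcongr
        refine (Finset.abs_sum_le_sum_abs _ _).trans ((Finset.sum_le_sum hterm).trans ?_)
        simp
    _ = √(s : ℝ) * c := by rw [← mul_assoc, hs]

lemma empiricalMap_sum {ι : Type*} (J : Finset ι) (g : ι → Y → ℝ)
    (hg : ∀ j ∈ J, IsUnitFun P (g j)) (hX : ∀ i, Measurable (X i))
    (hlaw : ∀ i, μ.map (X i) = P) (s : ℕ) (ω : Ω) :
    empiricalMap μ X s (fun y => ∑ j ∈ J, g j y) ω = ∑ j ∈ J, empiricalMap μ X s (g j) ω := by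
  simp only [empiricalMap]
  rw [← Finset.mul_sum, Finset.sum_comm]
  congr 1
  refine Finset.sum_congr rfl fun i _ => ?_
  rw [integral_finsetSum J fun j hj => ((hg j hj).comp hX hlaw i).integrable,
    Finset.sum_sub_distrib]

/-- The empirical process at a function `h` with `0 ≤ h ≤ g` is controlled by the one at `g`, up
to a bias term. -/
lemma abs_empiricalMap_le_of_le {h g : Y → ℝ} (hh : IsUnitFun P h) (hg : IsUnitFun P g)
    (hle : ∀ y, h y ≤ g y) (hX : ∀ i, Measurable (X i))
    (hlaw : ∀ i, μ.map (X i) = P) (s : ℕ) (ω : Ω) :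
    |empiricalMap μ X s h ω| ≤ |empiricalMap μ X s g ω| + √(s : ℝ) * ∫ y, g y ∂P := by
  have hs : 1 / √(s : ℝ) * s = √(s : ℝ) := by
    rw [one_div, inv_mul_eq_div, Real.div_sqrt]
  -- Splitting off the mean leaves a sum that is monotone in `k`; only the mean of `g` has to be
  -- paid for.
  have key : ∀ k : Y → ℝ, IsUnitFun P k → empiricalMap μ X s k ω =
      1 / √(s : ℝ) * ∑ i ∈ Finset.range s, k (X i ω) - √(s : ℝ) * ∫ y, k y ∂P := by
    intro k hk
    simp only [empiricalMap, integral_comp_law hk.aemeasurable hX hlaw, Finset.sum_sub_distrib,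
      Finset.sum_const, Finset.card_range, nsmul_eq_mul, mul_sub]
    rw [← mul_assoc, hs]
  have hP : IsProbabilityMeasure P := by
    rw [← hlaw 0]; exact Measure.isProbabilityMeasure_map (hX 0).aemeasurable
  have hint : ∫ y, h y ∂P ≤ ∫ y, g y ∂P := integral_mono hh.integrable hg.integrable hle
  have hint0 : 0 ≤ ∫ y, h y ∂P := integral_nonneg hh.nonneg
  have hsum : 1 / √(s : ℝ) * ∑ i ∈ Finset.range s, h (X i ω)
      ≤ 1 / √(s : ℝ) * ∑ i ∈ Finset.range s, g (X i ω) := by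
    gcongr with i _
    exact hle _
  have hsum0 : 0 ≤ 1 / √(s : ℝ) * ∑ i ∈ Finset.range s, h (X i ω) :=
    mul_nonneg (by positivity) (Finset.sum_nonneg fun i _ => hh.nonneg _)
  have hr := Real.sqrt_nonneg (s : ℝ)
  have h1 := mul_le_mul_of_nonneg_left hint hr
  have h2 := mul_nonneg hr hint0
  have h3 := le_abs_self (empiricalMap μ X s g ω)
  have h4 := abs_nonneg (empiricalMap μ X s g ω)
  rw [abs_le, key h hh]
  rw [key g hg] at h3 h4 ⊢
  constructor <;> linarith

/-- An exponential moment of the empirical process from a bound for the moment generating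
function of its summands. -/
lemma integral_exp_abs_empiricalMap_le {g : Y → ℝ} (hg : IsUnitFun P g)
    (hX : ∀ i, Measurable (X i)) (hindep : iIndepFun X μ) (hlaw : ∀ i, μ.map (X i) = P)
    {s : ℕ} (hs : 1 ≤ s) {r v : ℝ}
    (hmgf : ∀ i t, |t| = |r| / √(s : ℝ) →
      mgf (fun ω => g (X i ω) - ∫ ω', g (X i ω') ∂μ) μ t ≤ Real.exp (t ^ 2 * v)) :
    Integrable (fun ω => Real.exp (r * |empiricalMap μ X s g ω|)) μ ∧
      ∫ ω, Real.exp (r * |empiricalMap μ X s g ω|) ∂μ ≤ 2 * Real.exp (r ^ 2 * v) := by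
  have hs0 : (0 : ℝ) < s := by exact_mod_cast hs
  have hsq : 0 < √(s : ℝ) := Real.sqrt_pos.2 hs0
  have hm := aemeasurable_empiricalMap hg hX hlaw s
  have hbd := abs_empiricalMap_le hg hX hlaw s hg.le_one
  have hint : ∀ t : ℝ, Integrable (fun ω => Real.exp (t * empiricalMap μ X s g ω)) μ := fun t =>
    integrable_exp_mul_of_mem_Icc hm (.of_forall fun ω => abs_le.1 (hbd ω))
  -- Independence factorises the moment generating function at `t / √s`; the `s` factors give `s *
  -- (t / √s) ^ 2 * v = t ^ 2 * v`, free of `s`.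
  have hind : iIndepFun (fun i ω => g (X i ω) - ∫ ω', g (X i ω') ∂μ) μ :=
    hindep.comp₀ (fun i y => g y - ∫ ω', g (X i ω') ∂μ) (fun i => (hX i).aemeasurable)
      (fun i => by rw [hlaw i]; exact hg.aemeasurable.sub_const _)
  have hside : ∀ t : ℝ, |t| = |r| →
      ∫ ω, Real.exp (t * empiricalMap μ X s g ω) ∂μ ≤ Real.exp (r ^ 2 * v) := by
    intro t ht
    have h1 : ∫ ω, Real.exp (t * empiricalMap μ X s g ω) ∂μ =
        mgf (∑ i ∈ Finset.range s, fun ω => g (X i ω) - ∫ ω', g (X i ω') ∂μ) μ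
          (t / √(s : ℝ)) := by
      unfold mgf empiricalMap
      congr 1
      ext ω
      simp only [Finset.sum_apply]
      congr 1
      ring
    rw [h1, hind.mgf_sum₀ (fun i => (hg.comp hX hlaw i).aemeasurable.sub_const _)]
    have h2 : ∀ i ∈ Finset.range s,
        mgf (fun ω => g (X i ω) - ∫ ω', g (X i ω') ∂μ) μ (t / √(s : ℝ)) ≤
          Real.exp ((t / √(s : ℝ)) ^ 2 * v) := fun i _ =>
      hmgf i _ (by rw [abs_div, abs_of_pos hsq, ht])
    refine (Finset.prod_le_prod (fun i _ => mgf_nonneg) h2).trans ?_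
    rw [Finset.prod_const, Finset.card_range, ← Real.exp_nat_mul, div_pow, Real.sq_sqrt hs0.le,
      ← sq_abs t, ht, sq_abs]
    apply le_of_eq
    congr 1
    field_simp
  have hle : ∀ ω, Real.exp (r * |empiricalMap μ X s g ω|) ≤
      Real.exp (r * empiricalMap μ X s g ω) + Real.exp (-r * empiricalMap μ X s g ω) := by
    intro ω
    rcases abs_choice (empiricalMap μ X s g ω) with h | h <;> rw [h]
    · linarith [Real.exp_pos (-r * empiricalMap μ X s g ω)]
    · rw [mul_neg, neg_mul]
      linarith [Real.exp_pos (r * empiricalMap μ X s g ω)]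
  have hI : Integrable (fun ω => Real.exp (r * |empiricalMap μ X s g ω|)) μ := by
    refine ((hint r).add (hint (-r))).mono' ?_ (.of_forall fun ω => ?_)
    · exact (Real.measurable_exp.comp_aemeasurable
        ((measurable_norm.comp_aemeasurable hm).const_mul r)).aestronglyMeasurable
    · rw [Real.norm_eq_abs, Real.abs_exp]
      exact hle ω
  refine ⟨hI, (integral_mono hI ((hint r).add (hint (-r))) hle).trans ?_⟩
  have := integral_add (hint r) (hint (-r))
  simp only [Pi.add_apply] at this ⊢
  rw [this]
  linarith [hside r rfl, hside (-r) (abs_neg r)]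

end Empirical

/-! ### Intersected brackets, stopping, and the decomposition of `f` -/

section Hull

variable {Y : Type*}

/-- The running maximum of `0, a 0, …, a q`. -/
def lowerHull (a : ℕ → Y → ℝ) : ℕ → Y → ℝ
  | 0 => fun y => max 0 (a 0 y)
  | q + 1 => fun y => max (lowerHull a q y) (a (q + 1) y)

/-- The running minimum of `1, b 0, …, b q`. -/
def upperHull (b : ℕ → Y → ℝ) : ℕ → Y → ℝ
  | 0 => fun y => min 1 (b 0 y)
  | q + 1 => fun y => min (upperHull b q y) (b (q + 1) y)

/-- The width of the intersection of the first brackets. -/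
def hullGap (a b : ℕ → Y → ℝ) (q : ℕ) (y : Y) : ℝ := upperHull b q y - lowerHull a q y

/-- The indicator of the set where the first `q` widths stay below their thresholds. -/
def survival (a b : ℕ → Y → ℝ) (t : ℕ → ℝ) : ℕ → Y → ℝ
  | 0 => fun _ => 1
  | q + 1 => fun y => if hullGap a b q y ≤ t q then survival a b t q y else 0

/-- The increments of the chain of lower bounds, where it has survived. -/
def lowerStep (a b : ℕ → Y → ℝ) (t : ℕ → ℝ) : ℕ → Y → ℝ
  | 0 => lowerHull a 0
  | q + 1 => fun y => (lowerHull a (q + 1) y - lowerHull a q y) * survival a b t (q + 1) y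

/-- The width of the intersection of the first brackets, where the chain stops. -/
def stoppedGap (a b : ℕ → Y → ℝ) (t : ℕ → ℝ) (q : ℕ) (y : Y) : ℝ :=
  hullGap a b q y * (survival a b t q y - survival a b t (q + 1) y)

variable {a b a' b' : ℕ → Y → ℝ} {t : ℕ → ℝ}

lemma lowerHull_congr {q : ℕ} (h : ∀ r ≤ q, a r = a' r) : lowerHull a q = lowerHull a' q := by
  induction q with
  | zero => simp [lowerHull, h 0 le_rfl]
  | succ q ih => simp [lowerHull, h (q + 1) le_rfl, ih fun r hr => h r (by omega)]

lemma upperHull_congr {q : ℕ} (h : ∀ r ≤ q, b r = b' r) : upperHull b q = upperHull b' q := by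
  induction q with
  | zero => simp [upperHull, h 0 le_rfl]
  | succ q ih => simp [upperHull, h (q + 1) le_rfl, ih fun r hr => h r (by omega)]

lemma hullGap_congr {q : ℕ} (ha : ∀ r ≤ q, a r = a' r) (hb : ∀ r ≤ q, b r = b' r) :
    hullGap a b q = hullGap a' b' q := by
  ext y
  rw [hullGap, hullGap, lowerHull_congr ha, upperHull_congr hb]

/-- Survival up to `q` tests only the widths of levels `< q`. Hence links of level `q` are
determined by the brackets of levels `≤ q`, which makes their number finite. -/
lemma survival_congr {q : ℕ} (ha : ∀ r < q, a r = a' r) (hb : ∀ r < q, b r = b' r) :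
    survival a b t q = survival a' b' t q := by
  induction q with
  | zero => rfl
  | succ q ih =>
    simp only [survival]
    rw [ih (fun r hr => ha r (by omega)) fun r hr => hb r (by omega),
      hullGap_congr (fun r hr => ha r (by omega)) fun r hr => hb r (by omega)]

lemma lowerStep_congr {q : ℕ} (ha : ∀ r ≤ q, a r = a' r) (hb : ∀ r ≤ q, b r = b' r) :
    lowerStep a b t q = lowerStep a' b' t q := by
  cases q with
  | zero => exact lowerHull_congr ha
  | succ q =>
    simp only [lowerStep]
    rw [lowerHull_congr ha, lowerHull_congr fun r hr => ha r (by omega),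
      survival_congr (fun r hr => ha r (by omega)) fun r hr => hb r (by omega)]

lemma stoppedGap_congr {q : ℕ} (ha : ∀ r ≤ q, a r = a' r) (hb : ∀ r ≤ q, b r = b' r) :
    stoppedGap a b t q = stoppedGap a' b' t q := by
  ext y
  rw [stoppedGap, stoppedGap, hullGap_congr ha hb,
    survival_congr (fun r hr => ha r hr.le) fun r hr => hb r hr.le,
    survival_congr (fun r hr => ha r (by omega)) fun r hr => hb r (by omega)]

lemma survival_eq_zero_or_one (q : ℕ) (y : Y) :
    survival a b t q y = 0 ∨ survival a b t q y = 1 := by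
  induction q with
  | zero => exact Or.inr rfl
  | succ q ih =>
    by_cases h : hullGap a b q y ≤ t q
    · simpa [survival, h] using ih
    · simp [survival, h]

lemma lowerHull_nonneg (q : ℕ) (y : Y) : 0 ≤ lowerHull a q y := by
  induction q with
  | zero => exact le_max_left _ _
  | succ q ih => exact ih.trans (le_max_left _ _)

lemma upperHull_le_one (q : ℕ) (y : Y) : upperHull b q y ≤ 1 := by
  induction q with
  | zero => exact min_le_left _ _
  | succ q ih => exact (min_le_left _ _).trans ih

lemma le_lowerHull (q : ℕ) (y : Y) : a q y ≤ lowerHull a q y := by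
  cases q <;> exact le_max_right _ _

lemma upperHull_le (q : ℕ) (y : Y) : upperHull b q y ≤ b q y := by
  cases q <;> exact min_le_right _ _

lemma lowerHull_le_succ (q : ℕ) (y : Y) : lowerHull a q y ≤ lowerHull a (q + 1) y :=
  le_max_left _ _

lemma hullGap_succ_le (q : ℕ) (y : Y) : hullGap a b (q + 1) y ≤ hullGap a b q y :=
  sub_le_sub (min_le_left _ _) (le_max_left _ _)

lemma hullGap_le (q : ℕ) (y : Y) : hullGap a b q y ≤ b q y - a q y :=
  sub_le_sub (upperHull_le q y) (le_lowerHull q y)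

lemma hullGap_le_one (q : ℕ) (y : Y) : hullGap a b q y ≤ 1 := by
  have h1 := upperHull_le_one (b := b) q y
  have h2 := lowerHull_nonneg (a := a) q y
  unfold hullGap
  linarith

/-- `f` has values in `[0, 1]` and lies in all brackets `[a r, b r]`. -/
structure IsChain (f : Y → ℝ) (a b : ℕ → Y → ℝ) : Prop where
  nonneg : ∀ y, 0 ≤ f y
  le_one : ∀ y, f y ≤ 1
  lower_le : ∀ q y, a q y ≤ f y
  le_upper : ∀ q y, f y ≤ b q y

variable {f : Y → ℝ}

lemma IsChain.lowerHull_le (h : IsChain f a b) (q : ℕ) (y : Y) : lowerHull a q y ≤ f y := by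
  induction q with
  | zero => exact max_le (h.nonneg y) (h.lower_le 0 y)
  | succ q ih => exact max_le ih (h.lower_le _ y)

lemma IsChain.le_upperHull (h : IsChain f a b) (q : ℕ) (y : Y) : f y ≤ upperHull b q y := by
  induction q with
  | zero => exact le_min (h.le_one y) (h.le_upper 0 y)
  | succ q ih => exact le_min ih (h.le_upper _ y)

lemma IsChain.hullGap_nonneg (h : IsChain f a b) (q : ℕ) (y : Y) : 0 ≤ hullGap a b q y :=
  sub_nonneg.2 ((h.lowerHull_le q y).trans (h.le_upperHull q y))

lemma IsChain.sub_lowerHull_le (h : IsChain f a b) (q : ℕ) (y : Y) :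
    f y - lowerHull a q y ≤ hullGap a b q y :=
  sub_le_sub_right (h.le_upperHull q y) _

lemma survival_nonneg (q : ℕ) (y : Y) : 0 ≤ survival a b t q y := by
  rcases survival_eq_zero_or_one (a := a) (b := b) (t := t) q y with h | h <;> simp [h]

lemma survival_le_one (q : ℕ) (y : Y) : survival a b t q y ≤ 1 := by
  rcases survival_eq_zero_or_one (a := a) (b := b) (t := t) q y with h | h <;> simp [h]

lemma survival_succ_le (q : ℕ) (y : Y) : survival a b t (q + 1) y ≤ survival a b t q y := by
  simp only [survival]
  split_ifs
  · exact le_rfl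
  · exact survival_nonneg q y

/-- Where the chain has survived, the widths lie below their thresholds. -/
lemma hullGap_mul_survival_le (ht : ∀ q, 0 ≤ t q) (q : ℕ) (y : Y) :
    hullGap a b q y * survival a b t (q + 1) y ≤ t q := by
  simp only [survival]
  split_ifs with h
  · rcases survival_eq_zero_or_one (a := a) (b := b) (t := t) q y with h' | h' <;> rw [h']
    · simpa using ht q
    · simpa using h
  · simpa using ht q

lemma lowerStep_nonneg (q : ℕ) (y : Y) :
    0 ≤ lowerStep a b t q y := by
  cases q with
  | zero => exact lowerHull_nonneg 0 y
  | succ q => exact mul_nonneg (sub_nonneg.2 (lowerHull_le_succ q y)) (survival_nonneg _ y)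

lemma IsChain.lowerStep_succ_le (h : IsChain f a b) (q : ℕ) (y : Y) :
    lowerStep a b t (q + 1) y ≤ hullGap a b q y * survival a b t (q + 1) y := by
  refine mul_le_mul_of_nonneg_right (sub_le_sub_right ?_ _) (survival_nonneg _ y)
  exact (h.lowerHull_le _ y).trans (h.le_upperHull q y)

lemma IsChain.stoppedGap_nonneg (h : IsChain f a b) (q : ℕ) (y : Y) :
    0 ≤ stoppedGap a b t q y :=
  mul_nonneg (h.hullGap_nonneg q y) (sub_nonneg.2 (survival_succ_le q y))

lemma IsChain.stoppedGap_le (h : IsChain f a b) (q : ℕ) (y : Y) :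
    stoppedGap a b t q y ≤ hullGap a b q y * survival a b t q y :=
  mul_le_mul_of_nonneg_left (sub_le_self _ (survival_nonneg _ y)) (h.hullGap_nonneg q y)

/-- Stopping at level `q + 1` presupposes survival of the test at level `q`, so stopped widths obey
the same bounds as the increments of the lower ends. -/
lemma IsChain.stoppedGap_succ_le (h : IsChain f a b) (q : ℕ) (y : Y) :
    stoppedGap a b t (q + 1) y ≤ hullGap a b q y * survival a b t (q + 1) y :=
  (h.stoppedGap_le _ y).trans
    (mul_le_mul_of_nonneg_right (hullGap_succ_le q y) (survival_nonneg _ y))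

lemma IsChain.hullGap_mul_survival_le_self (h : IsChain f a b) (q r : ℕ) (y : Y) :
    hullGap a b q y * survival a b t r y ≤ hullGap a b q y :=
  mul_le_of_le_one_right (h.hullGap_nonneg q y) (survival_le_one r y)

/-- Markov's inequality, pointwise. -/
lemma IsChain.mul_stoppedGap_le (h : IsChain f a b) (q : ℕ) (y : Y) :
    t q * stoppedGap a b t q y ≤ hullGap a b q y ^ 2 := by
  have h0 := h.hullGap_nonneg q y
  simp only [stoppedGap, survival]
  split_ifs with hq
  · simpa using sq_nonneg _
  · rcases survival_eq_zero_or_one (a := a) (b := b) (t := t) q y with h' | h' <;> rw [h']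
    · simpa using sq_nonneg _
    · nlinarith [not_le.1 hq]

/-- The part of `f` that is added where the chain stops. -/
def stoppedRest (f : Y → ℝ) (a b : ℕ → Y → ℝ) (t : ℕ → ℝ) (q : ℕ) (y : Y) : ℝ :=
  (f y - lowerHull a q y) * (survival a b t q y - survival a b t (q + 1) y)

/-- The part of `f` that is left where the chain has survived. -/
def survivingRest (f : Y → ℝ) (a b : ℕ → Y → ℝ) (t : ℕ → ℝ) (q : ℕ) (y : Y) : ℝ :=
  (f y - lowerHull a q y) * survival a b t (q + 1) y

/-- Telescoping: the surviving remainder of level `Q` equals the next increment plus a remainder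
relative to the next lower end, and the test at level `Q + 1` splits the latter into a stopped and a
surviving part. -/
lemma chain_decomposition (f : Y → ℝ) (a b : ℕ → Y → ℝ) (t : ℕ → ℝ) (Q : ℕ) (y : Y) :
    f y = ∑ q ∈ Finset.range (Q + 1), lowerStep a b t q y
      + ∑ q ∈ Finset.range (Q + 1), stoppedRest f a b t q y + survivingRest f a b t Q y := by
  induction Q with
  | zero =>
    simp only [zero_add, Finset.sum_range_one, lowerStep, stoppedRest, survivingRest]
    simp only [survival]
    ring
  | succ Q ih =>
    rw [Finset.sum_range_succ, Finset.sum_range_succ (fun q => stoppedRest f a b t q y)]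
    conv_lhs => rw [ih]
    simp only [lowerStep, stoppedRest, survivingRest]
    ring

lemma IsChain.stoppedRest_nonneg (h : IsChain f a b) (q : ℕ) (y : Y) :
    0 ≤ stoppedRest f a b t q y :=
  mul_nonneg (sub_nonneg.2 (h.lowerHull_le q y)) (sub_nonneg.2 (survival_succ_le q y))

lemma IsChain.stoppedRest_le (h : IsChain f a b) (q : ℕ) (y : Y) :
    stoppedRest f a b t q y ≤ stoppedGap a b t q y :=
  mul_le_mul_of_nonneg_right (h.sub_lowerHull_le q y) (sub_nonneg.2 (survival_succ_le q y))

lemma IsChain.survivingRest_nonneg (h : IsChain f a b) (q : ℕ) (y : Y) :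
    0 ≤ survivingRest f a b t q y :=
  mul_nonneg (sub_nonneg.2 (h.lowerHull_le q y)) (survival_nonneg _ y)

lemma IsChain.survivingRest_le (h : IsChain f a b) (q : ℕ) (y : Y) :
    survivingRest f a b t q y ≤ hullGap a b q y * survival a b t (q + 1) y :=
  mul_le_mul_of_nonneg_right (h.sub_lowerHull_le q y) (survival_nonneg _ y)

/-! ### Measurability of the links and the chaining bound for one `f` -/

section Measurability

variable [MeasurableSpace Y] {P : Measure Y}

lemma aemeasurable_lowerHull (ha : ∀ q, AEMeasurable (a q) P) (q : ℕ) :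
    AEMeasurable (lowerHull a q) P := by
  induction q with
  | zero => exact aemeasurable_const.max (ha 0)
  | succ q ih => exact ih.max (ha _)

lemma aemeasurable_upperHull (hb : ∀ q, AEMeasurable (b q) P) (q : ℕ) :
    AEMeasurable (upperHull b q) P := by
  induction q with
  | zero => exact aemeasurable_const.min (hb 0)
  | succ q ih => exact ih.min (hb _)

lemma aemeasurable_hullGap (ha : ∀ q, AEMeasurable (a q) P) (hb : ∀ q, AEMeasurable (b q) P)
    (q : ℕ) : AEMeasurable (hullGap a b q) P :=
  (aemeasurable_upperHull hb q).sub (aemeasurable_lowerHull ha q)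

lemma aemeasurable_survival (ha : ∀ q, AEMeasurable (a q) P) (hb : ∀ q, AEMeasurable (b q) P)
    (q : ℕ) : AEMeasurable (survival a b t q) P := by
  induction q with
  | zero => exact aemeasurable_const
  | succ q ih =>
    have hi : Measurable fun x : ℝ => if x ≤ t q then (1 : ℝ) else 0 :=
      Measurable.ite measurableSet_Iic measurable_const measurable_const
    have : survival a b t (q + 1) =
        fun y => (if hullGap a b q y ≤ t q then (1 : ℝ) else 0) * survival a b t q y := by
      ext y
      simp [survival]
    rw [this]
    exact (hi.comp_aemeasurable (aemeasurable_hullGap ha hb q)).mul ih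

lemma IsChain.isUnitFun_lowerStep (h : IsChain f a b) (ha : ∀ q, AEMeasurable (a q) P)
    (hb : ∀ q, AEMeasurable (b q) P) (q : ℕ) : IsUnitFun P (lowerStep a b t q) where
  aemeasurable := by
    cases q with
    | zero => exact aemeasurable_lowerHull ha 0
    | succ q =>
      exact ((aemeasurable_lowerHull ha _).sub (aemeasurable_lowerHull ha _)).mul
        (aemeasurable_survival ha hb _)
  nonneg := lowerStep_nonneg q
  le_one y := by
    cases q with
    | zero => exact (h.lowerHull_le 0 y).trans (h.le_one y)
    | succ q =>
      exact (h.lowerStep_succ_le q y).trans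
        ((h.hullGap_mul_survival_le_self q _ y).trans (hullGap_le_one q y))

lemma IsChain.isUnitFun_stoppedGap (h : IsChain f a b) (ha : ∀ q, AEMeasurable (a q) P)
    (hb : ∀ q, AEMeasurable (b q) P) (q : ℕ) : IsUnitFun P (stoppedGap a b t q) where
  aemeasurable := (aemeasurable_hullGap ha hb q).mul
    ((aemeasurable_survival ha hb _).sub (aemeasurable_survival ha hb _))
  nonneg := h.stoppedGap_nonneg q
  le_one y := (h.stoppedGap_le q y).trans
    ((h.hullGap_mul_survival_le_self q _ y).trans (hullGap_le_one q y))

lemma IsChain.isUnitFun_hullGap (h : IsChain f a b) (ha : ∀ q, AEMeasurable (a q) P)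
    (hb : ∀ q, AEMeasurable (b q) P) (q : ℕ) : IsUnitFun P (hullGap a b q) where
  aemeasurable := aemeasurable_hullGap ha hb q
  nonneg := h.hullGap_nonneg q
  le_one := hullGap_le_one q

lemma IsChain.isUnitFun_stoppedRest (h : IsChain f a b) (hf : AEMeasurable f P)
    (ha : ∀ q, AEMeasurable (a q) P) (hb : ∀ q, AEMeasurable (b q) P) (q : ℕ) :
    IsUnitFun P (stoppedRest f a b t q) where
  aemeasurable := (hf.sub (aemeasurable_lowerHull ha q)).mul
    ((aemeasurable_survival ha hb _).sub (aemeasurable_survival ha hb _))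
  nonneg := h.stoppedRest_nonneg q
  le_one y := (h.stoppedRest_le q y).trans ((h.isUnitFun_stoppedGap ha hb q).le_one y)

lemma IsChain.isUnitFun_survivingRest (h : IsChain f a b) (hf : AEMeasurable f P)
    (ha : ∀ q, AEMeasurable (a q) P) (hb : ∀ q, AEMeasurable (b q) P) (q : ℕ) :
    IsUnitFun P (survivingRest f a b t q) where
  aemeasurable := (hf.sub (aemeasurable_lowerHull ha q)).mul (aemeasurable_survival ha hb _)
  nonneg := h.survivingRest_nonneg q
  le_one y := (h.survivingRest_le q y).trans
    ((h.hullGap_mul_survival_le_self q _ y).trans (hullGap_le_one q y))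

/-- The chaining bound for the empirical process at one function. -/
lemma IsChain.abs_empiricalMap_le {Ω : Type*} [MeasurableSpace Ω] {μ : Measure Ω}
    [IsProbabilityMeasure μ] {X : ℕ → Ω → Y} (h : IsChain f a b) (hf : AEMeasurable f P)
    (ha : ∀ q, AEMeasurable (a q) P) (hb : ∀ q, AEMeasurable (b q) P)
    (hX : ∀ i, Measurable (X i)) (hlaw : ∀ i, μ.map (X i) = P) (ht : ∀ q, 0 ≤ t q)
    (s Q : ℕ) (ω : Ω) :
    |empiricalMap μ X s f ω| ≤ ∑ q ∈ Finset.range (Q + 1),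
        (|empiricalMap μ X s (lowerStep a b t q) ω| + |empiricalMap μ X s (stoppedGap a b t q) ω|
          + √(s : ℝ) * ∫ y, stoppedGap a b t q y ∂P) + √(s : ℝ) * t Q := by
  have hS : ∀ q, IsUnitFun P (lowerStep a b t q) := h.isUnitFun_lowerStep ha hb
  have hR : ∀ q, IsUnitFun P (stoppedRest f a b t q) := h.isUnitFun_stoppedRest hf ha hb
  have hV := h.isUnitFun_survivingRest (t := t) hf ha hb Q
  -- One index type for all pieces, `none` being the surviving remainder, so that linearity is
  -- applied once.
  let g : Option (Fin 2 × ℕ) → Y → ℝ := fun o => o.elim (survivingRest f a b t Q)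
    fun p => if p.1 = 0 then lowerStep a b t p.2 else stoppedRest f a b t p.2
  have hg : ∀ o, IsUnitFun P (g o) := by
    rintro (_ | ⟨p, q⟩)
    · exact hV
    · by_cases hp : p = 0
      · simpa [g, hp] using hS q
      · simpa [g, hp] using hR q
  have hdec : f = fun y => ∑ o ∈ Finset.insertNone
      ((Finset.univ : Finset (Fin 2)) ×ˢ Finset.range (Q + 1)), g o y := by
    ext y
    rw [Finset.sum_insertNone, Finset.sum_product]
    simp only [Fin.sum_univ_two, g, Option.elim]
    rw [chain_decomposition f a b t Q y]
    simp
    ring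
  have hval : empiricalMap μ X s f ω = empiricalMap μ X s (survivingRest f a b t Q) ω
      + (∑ q ∈ Finset.range (Q + 1), empiricalMap μ X s (lowerStep a b t q) ω
      + ∑ q ∈ Finset.range (Q + 1), empiricalMap μ X s (stoppedRest f a b t q) ω) := by
    conv_lhs => rw [hdec]
    rw [empiricalMap_sum _ g (fun o _ => hg o) hX hlaw, Finset.sum_insertNone,
      Finset.sum_product]
    simp [g]
  have h1 := BracketingChaining.abs_empiricalMap_le hV hX hlaw s
    (fun y => (h.survivingRest_le Q y).trans (hullGap_mul_survival_le ht Q y)) ω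
  have h2 : ∀ q ∈ Finset.range (Q + 1), |empiricalMap μ X s (stoppedRest f a b t q) ω| ≤
      |empiricalMap μ X s (stoppedGap a b t q) ω| + √(s : ℝ) * ∫ y, stoppedGap a b t q y ∂P :=
    fun q _ => abs_empiricalMap_le_of_le (hR q) (h.isUnitFun_stoppedGap ha hb q)
      (h.stoppedRest_le q) hX hlaw s ω
  have h3 := Finset.abs_sum_le_sum_abs
    (fun q => empiricalMap μ X s (lowerStep a b t q) ω) (Finset.range (Q + 1))
  have h4 := (Finset.abs_sum_le_sum_abs
    (fun q => empiricalMap μ X s (stoppedRest f a b t q) ω) (Finset.range (Q + 1))).trans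
    (Finset.sum_le_sum h2)
  rw [hval]
  refine (abs_add_le _ _).trans ?_
  have h5 := abs_add_le (∑ q ∈ Finset.range (Q + 1), empiricalMap μ X s (lowerStep a b t q) ω)
    (∑ q ∈ Finset.range (Q + 1), empiricalMap μ X s (stoppedRest f a b t q) ω)
  simp only [Finset.sum_add_distrib] at h4 ⊢
  linarith

end Measurability

end Hull

/-! ### Combining the exponential moments of all levels -/

section Aggregation

/-- Weighted Jensen inequality for the exponential function; the remaining weight sits at `0`. -/
lemma exp_sum_div_le {ι : Type*} (J : Finset ι) (z r : ι → ℝ) (hr : ∀ j ∈ J, 0 < r j) {C : ℝ}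
    (hC : 0 < C) (hsum : ∑ j ∈ J, 1 / r j ≤ C) :
    Real.exp ((∑ j ∈ J, z j) / C) ≤
      ∑ j ∈ J, 1 / (r j * C) * Real.exp (r j * z j) + (1 - ∑ j ∈ J, 1 / (r j * C)) := by
  set x := (∑ j ∈ J, z j) / C with hx
  -- Jensen's inequality through the tangent of `exp` at the barycentre `x`.
  have htan : ∀ y : ℝ, Real.exp x * (1 + (y - x)) ≤ Real.exp y := by
    intro y
    have h := Real.add_one_le_exp (y - x)
    have : Real.exp y = Real.exp x * Real.exp (y - x) := by
      rw [← Real.exp_add]; congr 1; ring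
    rw [this]
    exact mul_le_mul_of_nonneg_left (by linarith) (Real.exp_pos x).le
  have hw : ∀ j ∈ J, 0 ≤ 1 / (r j * C) := fun j hj =>
    (one_div_pos.2 (mul_pos (hr j hj) hC)).le
  have hw1 : ∑ j ∈ J, 1 / (r j * C) ≤ 1 := by
    have : ∑ j ∈ J, 1 / (r j * C) = (∑ j ∈ J, 1 / r j) / C := by
      rw [Finset.sum_div]
      exact Finset.sum_congr rfl fun j _ => by rw [div_div]
    rw [this, div_le_one hC]
    exact hsum
  have h1 : ∑ j ∈ J, 1 / (r j * C) * (Real.exp x * (1 + (r j * z j - x))) ≤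
      ∑ j ∈ J, 1 / (r j * C) * Real.exp (r j * z j) :=
    Finset.sum_le_sum fun j hj => mul_le_mul_of_nonneg_left (htan _) (hw j hj)
  have h2 : ∑ j ∈ J, 1 / (r j * C) * (Real.exp x * (1 + (r j * z j - x))) =
      Real.exp x * ((1 - x) * ∑ j ∈ J, 1 / (r j * C) + x) := by
    have : ∀ j ∈ J, 1 / (r j * C) * (Real.exp x * (1 + (r j * z j - x))) =
        Real.exp x * ((1 - x) * (1 / (r j * C)) + z j / C) := by
      intro j hj
      have := (hr j hj).ne'
      field_simp
      ring
    rw [Finset.sum_congr rfl this, ← Finset.mul_sum, Finset.sum_add_distrib, ← Finset.mul_sum,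
      ← Finset.sum_div]
  -- The tangent bound at `0`, with the leftover weight; added to `h1`, the terms linear in `x`
  -- cancel.
  have h3 := mul_le_mul_of_nonneg_right (htan 0)
    (sub_nonneg.2 hw1)
  rw [Real.exp_zero, one_mul] at h3
  rw [h2] at h1
  nlinarith

/-- An exponential moment of a supremum that is dominated by finitely many suprema over finite
families. -/
lemma lintegral_exp_iSup_le {Ω T ι : Type*} [MeasurableSpace Ω] {μ : Measure Ω}
    [IsProbabilityMeasure μ] [Nonempty T] (J : Finset ι) (W : ι → T → Ω → ℝ) (Z : T → Ω → ℝ)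
    (r m K : ι → ℝ) (R : ι → Finset T) {C d : ℝ} (hC : 0 < C) (hr : ∀ j ∈ J, 0 < r j)
    (hrC : ∑ j ∈ J, 1 / r j ≤ C) (hmC : ∑ j ∈ J, m j + d ≤ C * Real.log 2)
    (hR : ∀ j ∈ J, ∀ f, ∃ f' ∈ R j, W j f' = W j f)
    (hint : ∀ j ∈ J, ∀ f, Integrable (fun ω => Real.exp (r j * W j f ω)) μ)
    (hK : ∀ j ∈ J, ∀ f, ∫ ω, Real.exp (r j * W j f ω) ∂μ ≤ K j)
    (hcard : ∀ j ∈ J, (R j).card * K j ≤ Real.exp (r j * m j))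
    (hZ : ∀ f ω, Z f ω ≤ ∑ j ∈ J, W j f ω + d) :
    ∫⁻ ω, ENNReal.ofReal (Real.exp ((⨆ f, Z f ω) / C)) ∂μ ≤ 2 := by
  set w : ι → ℝ := fun j => 1 / (r j * C) with hw
  have hw0 : ∀ j ∈ J, 0 ≤ w j := fun j hj => (one_div_pos.2 (mul_pos (hr j hj) hC)).le
  set G : ι → Ω → ℝ := fun j ω => ∑ f ∈ R j, Real.exp (r j * W j f ω) * Real.exp (-(r j * m j))
    with hG
  -- An integrable majorant independent of `f`: each `G j` is a finite sum with mean at most `1`,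
  -- and the weights add up to `1`.
  set Φ : Ω → ℝ := fun ω => ∑ j ∈ J, w j * G j ω + (1 - ∑ j ∈ J, w j) with hΦ
  have hGint : ∀ j ∈ J, Integrable (G j) μ := fun j hj =>
    integrable_finsetSum _ fun f _ => (hint j hj f).mul_const _
  have hGle : ∀ j ∈ J, ∫ ω, G j ω ∂μ ≤ 1 := by
    intro j hj
    rw [hG, integral_finsetSum _ fun f _ => (hint j hj f).mul_const _]
    calc ∑ f ∈ R j, ∫ ω, Real.exp (r j * W j f ω) * Real.exp (-(r j * m j)) ∂μ
        ≤ ∑ f ∈ R j, K j * Real.exp (-(r j * m j)) := by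
          refine Finset.sum_le_sum fun f _ => ?_
          rw [integral_mul_const]
          exact mul_le_mul_of_nonneg_right (hK j hj f) (Real.exp_pos _).le
      _ = (R j).card * K j * Real.exp (-(r j * m j)) := by simp [mul_assoc]
      _ ≤ Real.exp (r j * m j) * Real.exp (-(r j * m j)) :=
          mul_le_mul_of_nonneg_right (hcard j hj) (Real.exp_pos _).le
      _ = 1 := by rw [← Real.exp_add]; simp
  have hΦint : Integrable Φ μ :=
    (integrable_finsetSum _ fun j hj => (hGint j hj).const_mul _).add (integrable_const _)
  have hΦle : ∫ ω, Φ ω ∂μ ≤ 1 := by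
    rw [hΦ, integral_add (integrable_finsetSum _ fun j hj => (hGint j hj).const_mul _)
      (integrable_const _), integral_finsetSum _ fun j hj => (hGint j hj).const_mul _]
    simp only [integral_const_mul, integral_const, probReal_univ, smul_eq_mul, one_mul]
    have : ∑ j ∈ J, w j * ∫ ω, G j ω ∂μ ≤ ∑ j ∈ J, w j :=
      Finset.sum_le_sum fun j hj => mul_le_of_le_one_right (hw0 j hj) (hGle j hj)
    linarith
  have hpt : ∀ f ω, Real.exp ((Z f ω - (∑ j ∈ J, m j + d)) / C) ≤ Φ ω := by
    intro f ω
    calc Real.exp ((Z f ω - (∑ j ∈ J, m j + d)) / C)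
        ≤ Real.exp ((∑ j ∈ J, (W j f ω - m j)) / C) := by
          rw [Real.exp_le_exp, Finset.sum_sub_distrib]
          exact div_le_div_of_nonneg_right (by linarith [hZ f ω]) hC.le
      _ ≤ ∑ j ∈ J, w j * Real.exp (r j * (W j f ω - m j)) + (1 - ∑ j ∈ J, w j) :=
          exp_sum_div_le J _ r hr hC hrC
      _ ≤ Φ ω := by
          refine add_le_add_left (Finset.sum_le_sum fun j hj =>
            mul_le_mul_of_nonneg_left ?_ (hw0 j hj)) _
          obtain ⟨f', hf', hff⟩ := hR j hj f
          rw [mul_sub, sub_eq_add_neg, Real.exp_add, ← hff]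
          exact Finset.single_le_sum
            (f := fun f => Real.exp (r j * W j f ω) * Real.exp (-(r j * m j)))
            (fun _ _ => by positivity) hf'
  have hΦpos : ∀ ω, 0 < Φ ω := fun ω =>
    (Real.exp_pos _).trans_le (hpt (Classical.arbitrary T) ω)
  have hsup : ∀ ω, Real.exp ((⨆ f, Z f ω) / C) ≤ 2 * Φ ω := by
    intro ω
    -- Taking logarithms gives a bound uniform in `f`. The shift `∑ m j + d ≤ C * log 2` costs
    -- exactly the factor `2`.
    have h1 : ⨆ f, Z f ω ≤ C * Real.log 2 + C * Real.log (Φ ω) := by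
      refine ciSup_le fun f => ?_
      have := (Real.le_log_iff_exp_le (hΦpos ω)).2 (hpt f ω)
      rw [div_le_iff₀ hC] at this
      linarith
    rw [← Real.le_log_iff_exp_le (by linarith [hΦpos ω]),
      Real.log_mul two_ne_zero (hΦpos ω).ne', div_le_iff₀ hC]
    linarith
  calc ∫⁻ ω, ENNReal.ofReal (Real.exp ((⨆ f, Z f ω) / C)) ∂μ
      ≤ ∫⁻ ω, ENNReal.ofReal (2 * Φ ω) ∂μ :=
        lintegral_mono fun ω => ENNReal.ofReal_le_ofReal (hsup ω)
    _ = ENNReal.ofReal (∫ ω, 2 * Φ ω ∂μ) :=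
        (ofReal_integral_eq_lintegral_ofReal (hΦint.const_mul 2)
          (.of_forall fun ω => by simpa using (hΦpos ω).le)).symm
    _ ≤ 2 := by
        rw [integral_const_mul]
        refine (ENNReal.ofReal_le_ofReal (q := 2) (by linarith)).trans (by simp)

/-- Replaces a supremum over all of `F` by a maximum over one function for each initial string of
brackets. -/
lemma exists_finset_representatives {T κ : Type*} [Nonempty T] [Fintype κ] (key : T → κ) :
    ∃ R : Finset T, R.card ≤ Fintype.card κ ∧ ∀ f, ∃ f' ∈ R, key f' = key f := by
  classical
  refine ⟨Finset.univ.image (Function.invFun key), Finset.card_image_le, fun f =>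
    ⟨Function.invFun key (key f), Finset.mem_image_of_mem _ (Finset.mem_univ _),
      Function.invFun_eq ⟨f, rfl⟩⟩⟩

end Aggregation

/-! ### Entropy sums -/

section Entropy

/-- The accumulated square root entropy `∑_{r ≤ q} √(2 + log N_r)`. -/
def entropySum (N : ℕ → ℕ) (q : ℕ) : ℝ := ∑ r ∈ Finset.range (q + 1), √(2 + Real.log (N r : ℝ))

/-- The partial sums of the entropy series. -/
def entropySeries (N : ℕ → ℕ) (n : ℕ) : ℝ :=
  ∑ q ∈ Finset.range n, (1 / 2 : ℝ) ^ q * √(2 + Real.log (N q : ℝ))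

lemma one_le_sqrt_two_add_log (n : ℕ) : 1 ≤ √(2 + Real.log (n : ℝ)) :=
  Real.one_le_sqrt.2 (by linarith [Real.log_natCast_nonneg n])

lemma one_le_entropySum (N : ℕ → ℕ) (q : ℕ) : 1 ≤ entropySum N q :=
  (one_le_sqrt_two_add_log (N 0)).trans
    (Finset.single_le_sum (f := fun r => √(2 + Real.log (N r : ℝ)))
      (fun _ _ => Real.sqrt_nonneg _) (Finset.mem_range.2 q.succ_pos))

lemma one_le_entropySeries_succ (N : ℕ → ℕ) (n : ℕ) : 1 ≤ entropySeries N (n + 1) := by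
  have h := Finset.single_le_sum (f := fun q => (1 / 2 : ℝ) ^ q * √(2 + Real.log (N q : ℝ)))
      (fun _ _ => by positivity) (Finset.mem_range.2 n.succ_pos)
  have h1 := one_le_sqrt_two_add_log (N 0)
  simp only [pow_zero, one_mul] at h
  exact h1.trans h

lemma prod_le_exp_sum_log (N : ℕ → ℕ) (n : ℕ) :
    (∏ r ∈ Finset.range n, (N r : ℝ)) ≤ Real.exp (∑ r ∈ Finset.range n, Real.log (N r : ℝ)) := by
  rw [Real.exp_sum]
  refine Finset.prod_le_prod (fun _ _ => by positivity) fun r _ => ?_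
  -- This includes `N r = 0`, where `log 0 = 0` gives `0 ≤ 1`.
  exact Real.le_exp_log _

/-- The square of a sum of nonnegative terms dominates the sum of squares, here `∑ (2 + log N r)`;
the summand `2` pays for the factor `2 ≤ exp 1`. -/
lemma two_mul_prod_le_exp_entropySum (N : ℕ → ℕ) (q : ℕ) :
    2 * (∏ r ∈ Finset.range (q + 1), (N r : ℝ)) ≤ Real.exp (entropySum N q ^ 2) := by
  have h1 : ∑ r ∈ Finset.range (q + 1), (2 + Real.log (N r : ℝ)) ≤ entropySum N q ^ 2 := by
    have h := Finset.sum_sq_le_sq_sum_of_nonneg (s := Finset.range (q + 1))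
      (f := fun r => √(2 + Real.log (N r : ℝ))) (fun _ _ => Real.sqrt_nonneg _)
    refine le_trans (le_of_eq (Finset.sum_congr rfl fun r _ => ?_)) h
    rw [Real.sq_sqrt (by linarith [Real.log_natCast_nonneg (N r)])]
  have h2 : 1 + ∑ r ∈ Finset.range (q + 1), Real.log (N r : ℝ) ≤
      ∑ r ∈ Finset.range (q + 1), (2 + Real.log (N r : ℝ)) := by
    rw [Finset.sum_add_distrib]
    have : (0 : ℝ) ≤ q := q.cast_nonneg
    simp
    linarith
  calc 2 * (∏ r ∈ Finset.range (q + 1), (N r : ℝ))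
      ≤ Real.exp 1 * Real.exp (∑ r ∈ Finset.range (q + 1), Real.log (N r : ℝ)) := by
        gcongr
        · linarith [Real.add_one_le_exp 1]
        · exact prod_le_exp_sum_log N (q + 1)
    _ = Real.exp (1 + ∑ r ∈ Finset.range (q + 1), Real.log (N r : ℝ)) := (Real.exp_add _ _).symm
    _ ≤ Real.exp (entropySum N q ^ 2) := Real.exp_le_exp.2 (h2.trans h1)

/-- Exchange of summation: the geometric tail from `r` on is at most `2 * 2 ^ (-r)`. The induction
proves the exact identity. -/
lemma sum_pow_mul_entropySum_le (N : ℕ → ℕ) (n : ℕ) :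
    ∑ q ∈ Finset.range n, (1 / 2 : ℝ) ^ q * entropySum N q ≤ 2 * entropySeries N n := by
  have h : ∀ n, ∑ q ∈ Finset.range n, (1 / 2 : ℝ) ^ q * entropySum N q =
      2 * entropySeries N n
        - 2 * (1 / 2 : ℝ) ^ n * ∑ r ∈ Finset.range n, √(2 + Real.log (N r : ℝ)) := by
    intro n
    induction n with
    | zero => simp [entropySeries]
    | succ n ih =>
      rw [Finset.sum_range_succ, ih]
      simp only [entropySeries, entropySum, Finset.sum_range_succ]
      ring
  rw [h n]
  have : 0 ≤ 2 * (1 / 2 : ℝ) ^ n * ∑ r ∈ Finset.range n, √(2 + Real.log (N r : ℝ)) := by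
    positivity
  linarith

end Entropy

lemma integral_sq_le_of_eLpNorm_le {Y : Type*} [MeasurableSpace Y] {P : Measure Y} {g : Y → ℝ}
    (hg : MemLp g 2 P) {c : ℝ} (hc : 0 ≤ c) (h : eLpNorm g 2 P ≤ ENNReal.ofReal c) :
    ∫ y, g y ^ 2 ∂P ≤ c ^ 2 := by
  rw [hg.eLpNorm_eq_integral_rpow_norm two_ne_zero ENNReal.ofNat_ne_top,
    ENNReal.ofReal_le_ofReal_iff hc] at h
  have h0 : 0 ≤ ∫ y, g y ^ 2 ∂P := integral_nonneg fun y => sq_nonneg _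
  simp only [ENNReal.toReal_ofNat, Real.rpow_ofNat, Real.norm_eq_abs, sq_abs] at h
  rw [show (2 : ℝ)⁻¹ = 1 / 2 by norm_num, ← Real.sqrt_eq_rpow] at h
  calc ∫ y, g y ^ 2 ∂P = √(∫ y, g y ^ 2 ∂P) ^ 2 := (Real.sq_sqrt h0).symm
    _ ≤ c ^ 2 := pow_le_pow_left₀ (Real.sqrt_nonneg _) h 2

/-! ### Exponential moments of links and the chaining theorem -/

section Chaining

/-- The bound for the standard deviations of the links of level `q`. -/
def linkScale : ℕ → ℝ
  | 0 => 1
  | q + 1 => (1 / 2 : ℝ) ^ q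

lemma linkScale_pos (q : ℕ) : 0 < linkScale q := by
  cases q <;> simp [linkScale]

lemma linkScale_le (q : ℕ) : linkScale q ≤ 2 * (1 / 2 : ℝ) ^ q := by
  cases q with
  | zero => norm_num [linkScale]
  | succ q => simp only [linkScale, pow_succ]; linarith

/-- The truncation threshold of level `q`. -/
def linkThreshold (N : ℕ → ℕ) (s q : ℕ) : ℝ := √(s : ℝ) * (1 / 2 : ℝ) ^ q / entropySum N (q + 1)

variable {Ω Y : Type*} [MeasurableSpace Ω] [MeasurableSpace Y]
  {μ : Measure Ω} [IsProbabilityMeasure μ] {P : Measure Y} {X : ℕ → Ω → Y}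

/-- The exponential moment of a link of the chain. -/
lemma integral_exp_link_le {g : Y → ℝ} (hg : IsUnitFun P g) (hX : ∀ i, Measurable (X i))
    (hindep : iIndepFun X μ) (hlaw : ∀ i, μ.map (X i) = P) {s : ℕ} (hs : 1 ≤ s) (N : ℕ → ℕ)
    (q : ℕ) (hlink : ∀ p, q = p + 1 → (∀ y, g y ≤ linkThreshold N s p) ∧
      ∫ y, g y ^ 2 ∂P ≤ ((1 / 2 : ℝ) ^ p) ^ 2) :
    Integrable (fun ω => Real.exp
        (entropySum N q / linkScale q * |empiricalMap μ X s g ω|)) μ ∧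
      ∫ ω, Real.exp (entropySum N q / linkScale q * |empiricalMap μ X s g ω|) ∂μ ≤
        2 * Real.exp (entropySum N q ^ 2) := by
  have hh : 0 < entropySum N q := one_pos.trans_le (one_le_entropySum N q)
  have hσ := linkScale_pos q
  have hsq : 0 < √(s : ℝ) := Real.sqrt_pos.2 (by exact_mod_cast hs)
  have hexp : entropySum N q ^ 2 = (entropySum N q / linkScale q) ^ 2 * linkScale q ^ 2 := by
    field_simp
  rw [hexp]
  refine integral_exp_abs_empiricalMap_le hg hX hindep hlaw hs fun i t ht => ?_
  rw [abs_of_pos (div_pos hh hσ)] at ht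
  have hgi := hg.comp hX hlaw i
  cases q with
  | zero => simpa [linkScale] using mgf_centered_le_of_unit hgi t
  | succ p =>
    obtain ⟨hle, hsqle⟩ := hlink p rfl
    refine mgf_centered_le_of_mul_le_one hgi (b := linkThreshold N s p)
      (fun ω => hle _) ?_ ?_
    · rw [integral_comp_law (g := fun y => g y ^ 2) (hg.aemeasurable.pow_const 2) hX hlaw]
      exact hsqle
    · rw [ht, linkThreshold]
      simp only [linkScale]
      -- Equality by the choice of the threshold: the Bernstein range is used up to its end.
      apply le_of_eq
      field_simp

/-- Chaining: an exponential moment of the supremum of the empirical process. -/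
theorem lintegral_exp_iSup_empiricalMap_le
    (hX : ∀ i, Measurable (X i)) (hindep : iIndepFun X μ) (hlaw : ∀ i, μ.map (X i) = P)
    {F : Set (Y → ℝ)} [Nonempty F] (hFmeas : ∀ f ∈ F, Measurable f)
    (hFrange : ∀ f ∈ F, ∀ y, f y ∈ Set.Icc (0 : ℝ) 1)
    {N : ℕ → ℕ} {l u : (q : ℕ) → Fin (N q) → Y → ℝ}
    (hcover : ∀ q, F ⊆ ⋃ i, bracket (l q i) (u q i))
    (hl : ∀ q i, MemLp (l q i) 2 P) (hu : ∀ q i, MemLp (u q i) 2 P)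
    (hsize : ∀ q i, eLpNorm (u q i - l q i) 2 P ≤ ENNReal.ofReal ((1 / 2 : ℝ) ^ q))
    {s : ℕ} (hs : 1 ≤ s) :
    ∫⁻ ω, ENNReal.ofReal (Real.exp ((⨆ f : F, |empiricalMap μ X s f ω|) /
      (50 * entropySeries N (s + 2)))) ∂μ ≤ 2 := by
  have hchoice : ∀ (f : F) (q : ℕ), ∃ i, (f : Y → ℝ) ∈ bracket (l q i) (u q i) := fun f q => by
    simpa using hcover q f.2
  choose π hπ using hchoice
  let a : F → ℕ → Y → ℝ := fun f q => l q (π f q)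
  let b : F → ℕ → Y → ℝ := fun f q => u q (π f q)
  have hP : IsProbabilityMeasure P := by
    rw [← hlaw 0]; exact Measure.isProbabilityMeasure_map (hX 0).aemeasurable
  have hch : ∀ f : F, IsChain (f : Y → ℝ) (a f) (b f) := fun f =>
    ⟨fun y => (hFrange f f.2 y).1, fun y => (hFrange f f.2 y).2, fun q y => (hπ f q y).1,
      fun q y => (hπ f q y).2⟩
  have ha : ∀ f q, AEMeasurable (a f q) P := fun f q => (hl q _).aestronglyMeasurable.aemeasurable
  have hb : ∀ f q, AEMeasurable (b f q) P := fun f q => (hu q _).aestronglyMeasurable.aemeasurable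
  set t := linkThreshold N s with ht
  have hh : ∀ q, 1 ≤ entropySum N q := one_le_entropySum N
  have hh0 : ∀ q, 0 < entropySum N q := fun q => one_pos.trans_le (hh q)
  have ht0 : ∀ q, 0 ≤ t q := fun q => by
    have := hh0 (q + 1)
    simp only [ht, linkThreshold]
    positivity
  have hs0 : (0 : ℝ) < s := by exact_mod_cast hs
  have hsq : 0 < √(s : ℝ) := Real.sqrt_pos.2 hs0
  have hgap : ∀ f q, ∫ y, hullGap (a f) (b f) q y ^ 2 ∂P ≤ ((1 / 2 : ℝ) ^ q) ^ 2 := by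
    intro f q
    have hm : MemLp (u q (π f q) - l q (π f q)) 2 P := (hu q _).sub (hl q _)
    refine le_trans (integral_mono ((hch f).isUnitFun_hullGap (ha f) (hb f) q).integrable_sq
      hm.integrable_sq fun y => ?_) (integral_sq_le_of_eLpNorm_le hm (by positivity) (hsize q _))
    exact pow_le_pow_left₀ ((hch f).hullGap_nonneg q y) (hullGap_le q y) 2
  -- Markov bounds the integral by `4 ^ (-q) / t q`; the form of `t q` turns this, times `√s`, into
  -- `2 ^ (-q) * H (q + 1)`.
  have hbias : ∀ f q, √(s : ℝ) * ∫ y, stoppedGap (a f) (b f) t q y ∂P ≤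
      (1 / 2 : ℝ) ^ q * entropySum N (q + 1) := by
    intro f q
    have hi := ((hch f).isUnitFun_stoppedGap (t := t) (ha f) (hb f) q).integrable
    have h1 : t q * ∫ y, stoppedGap (a f) (b f) t q y ∂P ≤ ((1 / 2 : ℝ) ^ q) ^ 2 := by
      rw [← integral_const_mul]
      exact (integral_mono (hi.const_mul _)
        ((hch f).isUnitFun_hullGap (ha f) (hb f) q).integrable_sq
        ((hch f).mul_stoppedGap_le q)).trans (hgap f q)
    simp only [ht, linkThreshold] at h1 ⊢
    have hp : (0 : ℝ) < (1 / 2 : ℝ) ^ q := by positivity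
    have h2 := hh0 (q + 1)
    rw [div_mul_eq_mul_div, div_le_iff₀ h2] at h1
    refine le_of_mul_le_mul_left ?_ hp
    linarith
  have hlevel : ∀ q, ∃ R : Finset F, (R.card : ℝ) ≤ ∏ r ∈ Finset.range (q + 1), (N r : ℝ) ∧
      ∀ f, ∃ f' ∈ R, ∀ r ≤ q, π f' r = π f r := by
    intro q
    obtain ⟨R, hR, hR'⟩ := exists_finset_representatives
      (fun f : F => fun r : Fin (q + 1) => π f r)
    refine ⟨R, ?_, fun f => ?_⟩
    · rw [Fintype.card_pi] at hR
      simp only [Fintype.card_fin] at hR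
      rw [← Fin.prod_univ_eq_prod_range (fun r => (N r : ℝ)) (q + 1)]
      exact_mod_cast hR
    · obtain ⟨f', hf', hkey⟩ := hR' f
      exact ⟨f', hf', fun r hr => congrFun hkey ⟨r, by omega⟩⟩
  choose R hRcard hRrep using hlevel
  let g : Bool × ℕ → F → Y → ℝ := fun j f =>
    cond j.1 (lowerStep (a f) (b f) t j.2) (stoppedGap (a f) (b f) t j.2)
  let J : Finset (Bool × ℕ) := Finset.univ ×ˢ Finset.range (s + 1)
  have hg : ∀ j f, IsUnitFun P (g j f) := by
    rintro ⟨_ | _, q⟩ f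
    · exact (hch f).isUnitFun_stoppedGap (ha f) (hb f) q
    · exact (hch f).isUnitFun_lowerStep (ha f) (hb f) q
  have hlink : ∀ (c : Bool) (q : ℕ) f, (∀ y, g (c, q + 1) f y ≤ t q) ∧
      ∫ y, g (c, q + 1) f y ^ 2 ∂P ≤ ((1 / 2 : ℝ) ^ q) ^ 2 := by
    intro c q f
    have hle : ∀ y, g (c, q + 1) f y ≤
        hullGap (a f) (b f) q y * survival (a f) (b f) t (q + 1) y := by
      cases c
      · exact (hch f).stoppedGap_succ_le q
      · exact (hch f).lowerStep_succ_le q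
    refine ⟨fun y => (hle y).trans (hullGap_mul_survival_le ht0 q y),
      le_trans (integral_mono (hg _ f).integrable_sq
        ((hch f).isUnitFun_hullGap (ha f) (hb f) q).integrable_sq fun y => ?_) (hgap f q)⟩
    exact pow_le_pow_left₀ ((hg _ f).nonneg y)
      ((hle y).trans ((hch f).hullGap_mul_survival_le_self q _ y)) 2
  have hexp := fun (j : Bool × ℕ) f => integral_exp_link_le (hg j f) hX hindep hlaw hs N j.2
    (fun p hp => by
      obtain ⟨c, q⟩ := j
      obtain rfl : q = p + 1 := hp
      exact hlink c p f)
  -- The chain has levels `0, …, s`, but the bias at level `s` involves `H (s + 1)`.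
  set S := entropySeries N (s + 2) with hS
  have hS1 : 1 ≤ S := one_le_entropySeries_succ N (s + 1)
  have hsum2 := sum_pow_mul_entropySum_le N (s + 2)
  have hsum1 : ∑ q ∈ Finset.range (s + 1), (1 / 2 : ℝ) ^ q * entropySum N q ≤ 2 * S := by
    rw [Finset.sum_range_succ] at hsum2
    have := hh0 (s + 1)
    have : 0 ≤ (1 / 2 : ℝ) ^ (s + 1) * entropySum N (s + 1) := by positivity
    linarith
  -- The index shift in `H (q + 1)` costs another factor `2`.
  have hsum3 : ∑ q ∈ Finset.range (s + 1), (1 / 2 : ℝ) ^ q * entropySum N (q + 1) ≤ 4 * S := by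
    rw [Finset.sum_range_succ'] at hsum2
    have h0 := hh0 0
    have : ∑ q ∈ Finset.range (s + 1), (1 / 2 : ℝ) ^ q * entropySum N (q + 1) =
        2 * ∑ q ∈ Finset.range (s + 1), (1 / 2 : ℝ) ^ (q + 1) * entropySum N (q + 1) := by
      rw [Finset.mul_sum]
      exact Finset.sum_congr rfl fun q _ => by ring
    rw [this]
    simp only [pow_zero, one_mul] at hsum2
    linarith
  -- `m j` is chosen so that `r j * m j = 2 * H ^ 2`: one `H ^ 2` for the number of links, one for
  -- the exponential moment. In `d`, `4 * S` is the total bias and `1` the surviving remainder.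
  refine lintegral_exp_iSup_le J (fun j f ω => |empiricalMap μ X s (g j f) ω|)
    (fun f ω => |empiricalMap μ X s f ω|) (fun j => entropySum N j.2 / linkScale j.2)
    (fun j => 2 * (entropySum N j.2 * linkScale j.2))
    (fun j => 2 * Real.exp (entropySum N j.2 ^ 2)) (fun j => R j.2) (d := 4 * S + 1)
    (by linarith) (fun j _ => div_pos (hh0 _) (linkScale_pos _)) ?_ ?_ ?_
    (fun j _ f => (hexp j f).1) (fun j _ f => (hexp j f).2) ?_ ?_
  · rw [Finset.sum_product]
    simp only [Fintype.sum_bool]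
    have : ∑ q ∈ Finset.range (s + 1), 1 / (entropySum N q / linkScale q) ≤ 4 * S := by
      calc ∑ q ∈ Finset.range (s + 1), 1 / (entropySum N q / linkScale q)
          ≤ ∑ q ∈ Finset.range (s + 1), 2 * ((1 / 2 : ℝ) ^ q * entropySum N q) := by
            refine Finset.sum_le_sum fun q _ => ?_
            rw [one_div_div]
            have h1 := linkScale_le q
            have h2 : (0 : ℝ) < (1 / 2 : ℝ) ^ q := by positivity
            calc linkScale q / entropySum N q ≤ linkScale q :=
                  div_le_self (linkScale_pos q).le (hh q)
              _ ≤ 2 * ((1 / 2 : ℝ) ^ q * entropySum N q) := by nlinarith [hh q]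
        _ ≤ 4 * S := by rw [← Finset.mul_sum]; linarith
    linarith
  · rw [Finset.sum_product]
    simp only [Fintype.sum_bool]
    have : ∑ q ∈ Finset.range (s + 1), 2 * (entropySum N q * linkScale q) ≤ 8 * S := by
      calc ∑ q ∈ Finset.range (s + 1), 2 * (entropySum N q * linkScale q)
          ≤ ∑ q ∈ Finset.range (s + 1), 4 * ((1 / 2 : ℝ) ^ q * entropySum N q) :=
            Finset.sum_le_sum fun q _ => by nlinarith [hh0 q, linkScale_le q]
        _ ≤ 8 * S := by rw [← Finset.mul_sum]; linarith
    -- Two kinds of links at `8 * S` each, plus `4 * S + 1`, give at most `21 * S ≤ 50 * S * log 2`.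
    nlinarith [Real.log_two_gt_d9]
  · rintro ⟨c, q⟩ _ f
    obtain ⟨f', hf', heq⟩ := hRrep q f
    refine ⟨f', hf', ?_⟩
    have hA : ∀ r ≤ q, a f' r = a f r := fun r hr => by simp only [a, heq r hr]
    have hB : ∀ r ≤ q, b f' r = b f r := fun r hr => by simp only [b, heq r hr]
    have : g (c, q) f' = g (c, q) f := by
      cases c
      · exact stoppedGap_congr hA hB
      · exact lowerStep_congr hA hB
    simp only [this]
  · rintro ⟨c, q⟩ _
    have h1 := hh0 q
    have h2 := linkScale_pos q
    have h3 : entropySum N q / linkScale q * (2 * (entropySum N q * linkScale q)) =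
        entropySum N q ^ 2 + entropySum N q ^ 2 := by
      field_simp
      ring
    simp only
    rw [h3, Real.exp_add, ← mul_assoc]
    refine mul_le_mul_of_nonneg_right ?_ (Real.exp_pos _).le
    linarith [hRcard q, two_mul_prod_le_exp_entropySum N q]
  · intro f ω
    refine ((hch f).abs_empiricalMap_le (hFmeas f f.2).aemeasurable (ha f) (hb f) hX hlaw ht0
      s s ω).trans ?_
    -- Stopping the chain at level `Q = s` suffices because `s * 2 ^ (-s) ≤ 1`.
    have h1 : √(s : ℝ) * t s ≤ 1 := by
      have h2 : (s : ℝ) ≤ 2 ^ s := by exact_mod_cast Nat.lt_two_pow_self.le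
      have h3 : √(s : ℝ) * t s = s * (1 / 2 : ℝ) ^ s / entropySum N (s + 1) := by
        rw [ht, linkThreshold, mul_div_assoc', ← mul_assoc, Real.mul_self_sqrt hs0.le]
      rw [h3]
      refine (div_le_self (by positivity) (hh _)).trans ?_
      rw [one_div, inv_pow, ← div_eq_mul_inv]
      exact (div_le_one (by positivity)).2 h2
    have h2 : ∑ q ∈ Finset.range (s + 1), √(s : ℝ) * ∫ y, stoppedGap (a f) (b f) t q y ∂P ≤
        4 * S := (Finset.sum_le_sum fun q _ => hbias f q).trans hsum3
    rw [Finset.sum_product]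
    simp only [Fintype.sum_bool, g, cond_true, cond_false, Finset.sum_add_distrib]
    linarith

end Chaining

/-! ### Comparison of constants and conclusion -/

lemma fifty_le_constK'' {M : ℝ} (hM : 2 ≤ M) : 50 ≤ constK'' M := by
  have h1 : 0 < Real.log (3 / 2) := Real.log_pos (by norm_num)
  have h2 : Real.log (3 / 2) ≤ 1 / 2 := by
    linarith [Real.log_le_sub_one_of_pos (show (0 : ℝ) < 3 / 2 by norm_num)]
  have h3 : 0 < Real.log M := Real.log_pos (by linarith)
  have h4 : 8 ≤ constK' M := by
    rw [constK', le_div_iff₀ (mul_pos h1 (by linarith))]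
    nlinarith
  have h5 : 0 ≤ 4 / Real.log M := by positivity
  unfold constK''
  linarith

end

end BracketingChaining

theorem mainTheorem5 {Ω Y : Type*} [MeasurableSpace Ω] [MeasurableSpace Y]
    (μ : MeasureTheory.Measure Ω) [MeasureTheory.IsProbabilityMeasure μ]
    (P : MeasureTheory.Measure Y) (X : ℕ → Ω → Y)
    (hX : ∀ i, Measurable (X i))
    (hindep : ProbabilityTheory.iIndepFun X μ)
    (hlaw : ∀ i, μ.map (X i) = P)
    (F : Set (Y → ℝ)) (hFcount : F.Countable)
    (hFmeas : ∀ f ∈ F, Measurable f)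
    (hFrange : ∀ f ∈ F, ∀ y, f y ∈ Set.Icc (0 : ℝ) 1)
    (N : ℕ → ℕ) (l u : (q : ℕ) → Fin (N q) → Y → ℝ)
    (hcover : BracketingChaining.IsNestedMonotoneBracketingCover P F N l u)
    (s : ℕ) (hs : 1 ≤ s) (M : ℝ) (hM : 2 ≤ M) :
    BracketingChaining.orliczNorm (BracketingChaining.psiOne M)
        (fun ω => ⨆ f : F, |BracketingChaining.empiricalMap μ X s f ω|) μ
      ≤ ENNReal.ofReal (BracketingChaining.constK'' M) *
        ∑' q : ℕ, ENNReal.ofReal ((1 / 2 : ℝ) ^ q * √(2 + Real.log (N q : ℝ))) := by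
  open BracketingChaining in
  have hS : 0 < entropySeries N (s + 2) :=
    one_pos.trans_le (one_le_entropySeries_succ N (s + 1))
  have hC : 0 < 50 * entropySeries N (s + 2) := by linarith
  have hexp : ∫⁻ ω, ENNReal.ofReal (Real.exp ((⨆ f : F, |empiricalMap μ X s f ω|) /
      (50 * entropySeries N (s + 2)))) ∂μ ≤ 2 := by
    rcases isEmpty_or_nonempty F with hF | hF
    -- The supremum over the empty type is `0`, and `exp 0 = 1 ≤ 2`.
    · simp
    · exact lintegral_exp_iSup_empiricalMap_le hX hindep hlaw hFmeas hFrange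
        (fun q => (hcover.isCover q).cover) hcover.memLp_lower hcover.memLp_upper
        (fun q i => (hcover.size_lt q i).le) hs
  have hpsi : ∫⁻ ω, ENNReal.ofReal (psiOne M (|(⨆ f : F, |empiricalMap μ X s f ω|)| /
      (50 * entropySeries N (s + 2)))) ∂μ ≤ 1 := by
    calc ∫⁻ ω, ENNReal.ofReal (psiOne M (|(⨆ f : F, |empiricalMap μ X s f ω|)| /
          (50 * entropySeries N (s + 2)))) ∂μ
        ≤ ∫⁻ ω, 2⁻¹ * ENNReal.ofReal (Real.exp ((⨆ f : F, |empiricalMap μ X s f ω|) /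
          (50 * entropySeries N (s + 2)))) ∂μ := by
          refine MeasureTheory.lintegral_mono fun ω => ?_
          simp only [psiOne]
          rw [abs_of_nonneg (Real.iSup_nonneg fun f => abs_nonneg _),
            ENNReal.ofReal_mul (by positivity)]
          gcongr
          rw [one_div, ENNReal.ofReal_inv_of_pos (by linarith)]
          -- `1 / M ≤ 1 / 2` absorbs the bound `2` on the exponential moment.
          exact ENNReal.inv_le_inv.2 (by simpa using ENNReal.ofReal_le_ofReal hM)
      _ = 2⁻¹ * ∫⁻ ω, ENNReal.ofReal (Real.exp ((⨆ f : F, |empiricalMap μ X s f ω|) /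
          (50 * entropySeries N (s + 2)))) ∂μ :=
          MeasureTheory.lintegral_const_mul' _ _ (by simp)
      _ ≤ 2⁻¹ * 2 := by gcongr
      _ = 1 := ENNReal.inv_mul_cancel two_ne_zero ENNReal.ofNat_ne_top
  calc orliczNorm (psiOne M) (fun ω => ⨆ f : F, |empiricalMap μ X s f ω|) μ
      -- The admissible `C` involves only a finite partial sum, so a divergent series needs no
      -- separate case.
      ≤ ENNReal.ofReal (50 * entropySeries N (s + 2)) := iInf₂_le _ ⟨hC, hpsi⟩
    _ = ENNReal.ofReal 50 * ∑ q ∈ Finset.range (s + 2),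
          ENNReal.ofReal ((1 / 2 : ℝ) ^ q * √(2 + Real.log (N q : ℝ))) := by
        rw [ENNReal.ofReal_mul (by norm_num), entropySeries,
          ENNReal.ofReal_sum_of_nonneg fun _ _ => by positivity]
    _ ≤ _ := by
        gcongr
        · exact fifty_le_constK'' hM
        · exact ENNReal.sum_le_tsum _
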